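/- For strictly positive integers $k$ and $n$ let $$r_k^{1(2)}(n) = \#\{(x_1,\dots,x_k)\in\mathbb Z_{>0}^k : x_i\equiv 1 \pmod 2 \text{ for all } i,\ x_1^2+\cdots+x_k^2=n\},$$ and, for $a\in\{1,3\}$, $$c_k^{a(4)}(n) = \#\{(x_1,\dots,x_k)\in\mathbb Z_{>0}^k : x_i\equiv a \pmod 4 \text{ for all } i,\ x_1x_2+x_2x_3+\cdots+x_{k-1}x_k+x_kx_1=n\},$$ where the cyclic sum is $\sum_{i=1}^{k}x_ix_{i+1}$ with $x_{k+1}=x_1$ (so it is $x_1^2$ for $k=1$ and $2x_1x_2$ for $k=2$). Theorem (Dumont's conjecture). For all integers $k\ge 1$ and $n\ge 1$, $$r_k^{1(2)}(n) = c_k^{1(4)}(n)-(-1)^k\,c_k^{3(4)}(n),$$ equivalently $c_k^{1(4)}(n)=r_k^{1(2)}(n)+(-1)^k c_k^{3(4)}(n)$. -/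

import Mathlib

/-- The `k`-tuples of strictly positive integers congruent to `a` modulo `b` whose squares
sum to `n`. -/
def sumSquaresSolutions (a b k n : ℕ) : Set (Fin k → ℕ) :=
  {x | (∀ i, 0 < x i ∧ x i ≡ a [MOD b]) ∧ n = ∑ i, x i ^ 2}

/-- The `k`-tuples of strictly positive integers congruent to `a` modulo `b` whose cyclic sum
`x₁x₂ + x₂x₃ + ⋯ + xₖx₁` is `n`.  Here `finRotate k` is the cyclic successor `i ↦ i + 1` on
`Fin k`; for `k = 1` the sum is `x₁x₁`, for `k = 2` it is `x₁x₂ + x₂x₁`. -/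
def cyclicSolutions (a b k n : ℕ) : Set (Fin k → ℕ) :=
  {x | (∀ i, 0 < x i ∧ x i ≡ a [MOD b]) ∧ n = ∑ i, x i * x (finRotate k i)}

/-- Both solution sets are finite, so that `Set.ncard` below is the true cardinality. -/
theorem sumSquaresSolutions_finite (a b k n : ℕ) : (sumSquaresSolutions a b k n).Finite := by
  refine (Set.finite_Iic (fun _ : Fin k => n)).subset fun x hx i => ?_
  calc x i ≤ x i ^ 2 := Nat.le_self_pow two_ne_zero _
    _ ≤ ∑ j, x j ^ 2 :=
      Finset.single_le_sum (f := fun j => x j ^ 2) (fun _ _ => Nat.zero_le _) (Finset.mem_univ i)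
    _ = n := hx.2.symm

theorem cyclicSolutions_finite (a b k n : ℕ) : (cyclicSolutions a b k n).Finite := by
  refine (Set.finite_Iic (fun _ : Fin k => n)).subset fun x hx i => ?_
  calc x i ≤ x i * x (finRotate k i) := Nat.le_mul_of_pos_right _ (hx.1 _).1
    _ ≤ ∑ j, x j * x (finRotate k j) :=
      Finset.single_le_sum (f := fun j => x j * x (finRotate k j))
        (fun _ _ => Nat.zero_le _) (Finset.mem_univ i)
    _ = n := hx.2.symm

/-- `r_k^{a(b)}(n)`: the number of representations of `n` as an ordered sum of `k` squares of
positive integers congruent to `a` modulo `b`. -/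
noncomputable def rCount (a b k n : ℕ) : ℕ := (sumSquaresSolutions a b k n).ncard

/-- `c_k^{a(b)}(n)`: the number of representations of `n` as a cyclic sum of products of `k`
positive integers congruent to `a` modulo `b`. -/
noncomputable def cCount (a b k n : ℕ) : ℕ := (cyclicSolutions a b k n).ncard

/-!
Let `A` and `B` be the matrices with entries `q ^ ((4i+1)(4j+1))` and `q ^ ((4i+3)(4j+3))`,
`i, j ≥ 0`. The traces of `A ^ k` and `B ^ k` are the generating functions of the cyclic sums with
terms congruent to `1` and to `3` modulo `4`, and the generating function of the sums of `k` odd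
squares is `θ ^ k` with `θ = ∑ q ^ ((2i+1)²)`. The theorem says
`tr (A ^ k) = θ ^ k + tr ((-B) ^ k)`: the spectrum of `A` is `θ` together with the spectrum of `-B`.

This holds because of an explicit intertwiner (`intertwiner_mul`). The operator
`(R f)(i) = (1 - q ^ (16(i+1))) f(i+1) - q ^ 4 (1 - q ^ (16i+8)) f(i)` satisfies `R A = -B' R`, where
`B'`, with entries `q ^ ((4i+1)(4j+5) + 4)`, is conjugate to `B` by the diagonal matrix
`q ^ (8i)`. As `R` together with the functional `f ↦ f(0)` is invertible, `A` is similar to a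
block triangular matrix with diagonal blocks `μ` and `-B'`, for some scalar `μ`. Hence
`tr (A ^ k) = μ ^ k + tr ((-B') ^ k)` (`exists_trace_cyclicMatrix_pow`), and the case `k = 1` gives
`μ = tr A + tr B' = θ`, since an odd number is `1` or `3` modulo `4`.

Only the coefficient of `q ^ n` matters, so `q` is taken in a ring in which `q ^ (n + 1) = 0`; the
matrices can then be cut down to finite size without an error term.
-/

/-! ### Traces of matrix powers -/

/-- Summing over all paths with `k` steps, with a weight depending on the two ends only. -/
theorem sum_prod_path_mul {ι S : Type*} [Fintype ι] [DecidableEq ι] [CommRing S]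
    (M : Matrix ι ι S) (k : ℕ) (g : ι → ι → S) :
    ∑ x : Fin (k + 1) → ι, (∏ i : Fin k, M (x i.castSucc) (x i.succ)) * g (x 0) (x (Fin.last k)) =
      ∑ a, ∑ b, (M ^ k) a b * g a b := by
  induction k generalizing g with
  | zero =>
    rw [← (Equiv.funUnique (Fin 1) ι).symm.sum_comp]
    simp [Matrix.one_apply]
  | succ k ih =>
    rw [← (Fin.snocEquiv fun _ : Fin (k + 2) => ι).sum_comp, Fintype.sum_prod_type_right]
    have h : ∀ y : Fin (k + 1) → ι, ∑ c : ι,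
        (∏ i : Fin (k + 1), M ((Fin.snoc y c : Fin (k + 2) → ι) i.castSucc)
          ((Fin.snoc y c : Fin (k + 2) → ι) i.succ)) *
          g ((Fin.snoc y c : Fin (k + 2) → ι) 0) ((Fin.snoc y c : Fin (k + 2) → ι) (Fin.last _)) =
        (∏ i : Fin k, M (y i.castSucc) (y i.succ)) *
          ∑ c, M (y (Fin.last k)) c * g (y 0) c := by
      intro y
      rw [Finset.mul_sum]
      refine Finset.sum_congr rfl fun c _ => ?_
      rw [Fin.prod_univ_castSucc]
      have h0 : (Fin.snoc y c : Fin (k + 2) → ι) 0 = y 0 :=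
        Fin.snoc_castSucc (α := fun _ : Fin (k + 2) => ι) c y 0
      simp only [Fin.snoc_castSucc, Fin.succ_castSucc, Fin.succ_last, Fin.snoc_last, h0]
      ring
    refine (Finset.sum_congr rfl fun y _ => h y).trans ?_
    refine (ih fun a b => ∑ c, M b c * g a c).trans (Finset.sum_congr rfl fun a _ => ?_)
    simp only [pow_succ, Matrix.mul_apply, Finset.mul_sum, Finset.sum_mul]
    rw [Finset.sum_comm]
    simp only [mul_assoc]

theorem trace_pow_eq_sum_prod_finRotate {ι S : Type*} [Fintype ι] [DecidableEq ι] [CommRing S]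
    (M : Matrix ι ι S) {k : ℕ} (hk : 0 < k) :
    (M ^ k).trace = ∑ x : Fin k → ι, ∏ i, M (x i) (x (finRotate k i)) := by
  obtain ⟨k, rfl⟩ : ∃ m, k = m + 1 := ⟨k - 1, by omega⟩
  simp only [Fin.prod_univ_castSucc, finRotate_apply, Fin.coeSucc_eq_succ,
    Fin.last_add_one]
  rw [sum_prod_path_mul M k fun a b => M b a]
  simp [Matrix.trace, pow_succ, Matrix.mul_apply]

theorem trace_pow_of_first_column {S : Type*} [CommRing S] {N : ℕ}
    (K : Matrix (Fin (N + 1)) (Fin (N + 1)) S) (h : ∀ i : Fin N, K i.succ 0 = 0) (k : ℕ) :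
    (K ^ k).trace = K 0 0 ^ k + ((K.submatrix Fin.succ Fin.succ) ^ k).trace := by
  have key : (∀ i : Fin N, (K ^ k) i.succ 0 = 0) ∧ (K ^ k) 0 0 = K 0 0 ^ k ∧
      (K ^ k).submatrix Fin.succ Fin.succ = (K.submatrix Fin.succ Fin.succ) ^ k := by
    induction k with
    | zero =>
      refine ⟨fun i => by simp, by simp, ?_⟩
      simpa using Matrix.submatrix_one _ (Fin.succ_injective N)
    | succ k ih =>
      obtain ⟨h1, h2, h3⟩ := ih
      refine ⟨fun i => ?_, ?_, ?_⟩
      · simp [pow_succ, Matrix.mul_apply, Fin.sum_univ_succ, h, h1]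
      · simp [pow_succ, Matrix.mul_apply, Fin.sum_univ_succ, h, h2]
      · ext i j
        rw [pow_succ _ k, pow_succ _ k, ← h3]
        simp [Matrix.mul_apply, Fin.sum_univ_succ, h1]
  rw [← key.2.2, ← key.2.1]
  simp [Matrix.trace, Fin.sum_univ_succ]

/-! ### The intertwiner -/

section Intertwiner

variable {S : Type*} [CommRing S]

/-- The matrix `A` with entries `q ^ (x y)`, where `x`, `y` run over the first `N` positive integers
congruent to `1` modulo `4`. -/
def cyclicMatrix (q : S) (N : ℕ) : Matrix (Fin N) (Fin N) S :=
  Matrix.of fun i j => q ^ ((4 * (i : ℕ) + 1) * (4 * (j : ℕ) + 1))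

/-- The matrix `B'`. Its entries differ from the `q ^ ((4i+3)(4j+3))` by the factor `q ^ (8i - 8j)`,
which cancels in cyclic products. -/
def cyclicMatrixThree (q : S) (N : ℕ) : Matrix (Fin N) (Fin N) S :=
  Matrix.of fun i j => q ^ ((4 * (i : ℕ) + 1) * (4 * (j : ℕ) + 5) + 4)

/-- The operator `R` as a bidiagonal matrix, below a first row that represents the functional
`f ↦ f 0`. -/
def intertwiner (q : S) (N : ℕ) : Matrix (Fin (N + 1)) (Fin (N + 1)) S :=
  Matrix.of (Fin.cons (fun j => if (j : ℕ) = 0 then 1 else 0) fun i j =>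
    (if (j : ℕ) = i + 1 then 1 - q ^ (16 * ((i : ℕ) + 1)) else 0) +
      (if (j : ℕ) = i then -(q ^ 4 * (1 - q ^ (16 * (i : ℕ) + 8))) else 0))

theorem intertwiner_zero (q : S) (N : ℕ) (j : Fin (N + 1)) :
    intertwiner q N 0 j = if (j : ℕ) = 0 then 1 else 0 := rfl

theorem intertwiner_succ (q : S) {N : ℕ} (i : Fin N) (j : Fin (N + 1)) :
    intertwiner q N i.succ j =
      (if (j : ℕ) = i + 1 then 1 - q ^ (16 * ((i : ℕ) + 1)) else 0) +
        (if (j : ℕ) = i then -(q ^ 4 * (1 - q ^ (16 * (i : ℕ) + 8))) else 0) := rfl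

theorem isUnit_det_intertwiner {q : S} (hq : IsNilpotent q) (N : ℕ) :
    IsUnit (intertwiner q N).det := by
  rw [Matrix.det_of_isLowerTriangular]
  · refine IsUnit.prod_univ_iff.2 fun i => ?_
    refine Fin.cases ?_ (fun i => ?_) i
    · simp [intertwiner_zero]
    · have : (q ^ (16 * ((i : ℕ) + 1))) = q * q ^ (16 * (i : ℕ) + 15) := by ring
      simp only [intertwiner_succ, Fin.val_succ, if_true, Nat.succ_ne_self, if_false,
        add_zero, this]
      exact ((Commute.all _ _).isNilpotent_mul_right hq).isUnit_one_sub
  · intro i j hij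
    have hij : (i : ℕ) < j := hij
    induction i using Fin.cases with
    | zero => simp only [Fin.val_zero] at hij; simp [intertwiner_zero, hij.ne']
    | succ i =>
      simp only [Fin.val_succ] at hij
      have h1 : (j : ℕ) ≠ i + 1 := by omega
      have h2 : (j : ℕ) ≠ i := by omega
      simp [intertwiner_succ, h1, h2]

/-- The relation `R A = -B' R`. The bound on `N` makes the terms lost by truncation vanish. -/
theorem intertwiner_mul {q : S} {N : ℕ} (hq : q ^ (N + 1) = 0) (i : Fin N) (j : Fin (N + 1)) :
    (intertwiner q N * cyclicMatrix q (N + 1)) i.succ j =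
      -∑ l : Fin N, cyclicMatrixThree q N i l * intertwiner q N l.succ j := by
  obtain ⟨i, hi⟩ := i
  obtain ⟨j, hj⟩ := j
  have hL : (intertwiner q N * cyclicMatrix q (N + 1)) (Fin.succ ⟨i, hi⟩) ⟨j, hj⟩ =
      (1 - q ^ (16 * (i + 1))) * q ^ ((4 * (i + 1) + 1) * (4 * j + 1)) -
        q ^ 4 * (1 - q ^ (16 * i + 8)) * q ^ ((4 * i + 1) * (4 * j + 1)) := by
    simp only [Matrix.mul_apply, intertwiner_succ, cyclicMatrix, Matrix.of_apply]
    rw [Fin.sum_univ_eq_sum_range (fun l => ((if l = i + 1 then 1 - q ^ (16 * (i + 1)) else 0) +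
      (if l = i then -(q ^ 4 * (1 - q ^ (16 * i + 8))) else 0)) *
        q ^ ((4 * l + 1) * (4 * j + 1)))]
    simp only [add_mul, Finset.sum_add_distrib, ite_mul, zero_mul, Finset.sum_ite_eq',
      Finset.mem_range]
    rw [if_pos (by omega), if_pos (by omega)]
    ring
  have hR : ∑ l : Fin N, cyclicMatrixThree q N ⟨i, hi⟩ l * intertwiner q N l.succ ⟨j, hj⟩ =
      q ^ ((4 * i + 1) * (4 * j + 1) + 4) * (1 - q ^ (16 * j)) -
        q ^ ((4 * i + 1) * (4 * j + 5) + 4) * (q ^ 4 * (1 - q ^ (16 * j + 8))) := by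
    simp only [intertwiner_succ, cyclicMatrixThree, Matrix.of_apply]
    rw [Fin.sum_univ_eq_sum_range (fun l => q ^ ((4 * i + 1) * (4 * l + 5) + 4) *
      ((if j = l + 1 then 1 - q ^ (16 * (l + 1)) else 0) +
      (if j = l then -(q ^ 4 * (1 - q ^ (16 * l + 8))) else 0)))]
    simp only [mul_add, Finset.sum_add_distrib, mul_ite, mul_zero, Finset.sum_ite_eq,
      Finset.mem_range, sub_eq_add_neg]
    congr 1
    · rcases j with _ | j
      · simp
      · simp only [Nat.add_right_cancel_iff, Finset.sum_ite_eq, Finset.mem_range]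
        rw [if_pos (by omega)]
        ring
    · split_ifs with h
      · ring
      · -- the last column, where the missing entry of `B'` is a high power of `q`
        have : q ^ ((4 * i + 1) * (4 * j + 5) + 4) = 0 :=
          pow_eq_zero_of_le (by nlinarith) hq
        linear_combination q ^ 4 * (1 - q ^ (16 * j + 8)) * this
  rw [hL, hR]
  ring

theorem exists_trace_cyclicMatrix_pow {q : S} {N : ℕ} (hq : q ^ (N + 1) = 0) :
    ∃ μ : S, ∀ k : ℕ, (cyclicMatrix q (N + 1) ^ k).trace =
      μ ^ k + (-1) ^ k * (cyclicMatrixThree q N ^ k).trace := by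
  have hdet := isUnit_det_intertwiner ⟨N + 1, hq⟩ N
  set P := intertwiner q N
  set A := cyclicMatrix q (N + 1)
  -- `P A P⁻¹`, with the rows after the first already known from `R A = -B' R`
  let K : Matrix (Fin (N + 1)) (Fin (N + 1)) S :=
    Matrix.of (Fin.cons ((P * A * P⁻¹) 0) fun i => Fin.cons 0 fun j => -cyclicMatrixThree q N i j)
  have hK : K * P = P * A := by
    ext i j
    induction i using Fin.cases with
    | zero =>
      have : (P * A * P⁻¹ * P) 0 j = (P * A) 0 j := by
        rw [Matrix.nonsing_inv_mul_cancel_right _ _ hdet]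
      rw [← this, Matrix.mul_apply, Matrix.mul_apply]
      rfl
    | succ i =>
      rw [intertwiner_mul hq, Matrix.mul_apply, Fin.sum_univ_succ]
      simp [K, P]
  refine ⟨K 0 0, fun k => ?_⟩
  have hpow : K ^ k * P = P * A ^ k := by
    have : SemiconjBy P A K := hK.symm
    exact (this.pow_right k).eq.symm
  have hA : A ^ k = P⁻¹ * (K ^ k * P) := by
    rw [hpow, Matrix.nonsing_inv_mul_cancel_left _ _ hdet]
  have hsub : K.submatrix Fin.succ Fin.succ = -cyclicMatrixThree q N := by
    ext i j
    simp [K]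
  rw [hA, Matrix.trace_mul_comm, Matrix.mul_nonsing_inv_cancel_right _ _ hdet,
    trace_pow_of_first_column K (fun i => by simp [K]), hsub]
  rcases k.even_or_odd with h | h <;> simp [h.neg_pow]

/-- The truncated generating function identity. -/
theorem sum_pow_sq_pow_eq {q : S} {N : ℕ} (hq : q ^ (N + 1) = 0) {k : ℕ} (hk : 0 < k) :
    ∑ x : Fin k → Fin (2 * N + 1), q ^ (∑ i, (2 * (x i : ℕ) + 1) ^ 2) =
      ∑ x : Fin k → Fin (N + 1),
        q ^ (∑ i, (4 * (x i : ℕ) + 1) * (4 * (x (finRotate k i) : ℕ) + 1)) -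
      (-1) ^ k * ∑ x : Fin k → Fin N,
        q ^ (∑ i, (4 * (x i : ℕ) + 3) * (4 * (x (finRotate k i) : ℕ) + 3)) := by
  obtain ⟨μ, hμ⟩ := exists_trace_cyclicMatrix_pow hq
  have hθ : μ = ∑ i : Fin (2 * N + 1), q ^ ((2 * (i : ℕ) + 1) ^ 2) := by
    have h1 := hμ 1
    simp only [pow_one, Matrix.trace, Matrix.diag, cyclicMatrix, cyclicMatrixThree,
      Matrix.of_apply] at h1
    rw [Fin.sum_univ_eq_sum_range (fun i => q ^ ((4 * i + 1) * (4 * i + 1))),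
      Fin.sum_univ_eq_sum_range (fun i => q ^ ((4 * i + 1) * (4 * i + 5) + 4))] at h1
    rw [Fin.sum_univ_eq_sum_range (fun i => q ^ ((2 * i + 1) ^ 2))]
    have h2 : ∀ N : ℕ, ∑ i ∈ Finset.range (2 * N + 1), q ^ ((2 * i + 1) ^ 2) =
        ∑ i ∈ Finset.range (N + 1), q ^ ((4 * i + 1) * (4 * i + 1)) +
          ∑ i ∈ Finset.range N, q ^ ((4 * i + 1) * (4 * i + 5) + 4) := by
      intro N
      induction N with
      | zero => simp
      | succ N ih =>
        rw [show 2 * (N + 1) + 1 = 2 * N + 1 + 1 + 1 by ring, Finset.sum_range_succ,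
          Finset.sum_range_succ, ih,
          Finset.sum_range_succ (fun i => q ^ ((4 * i + 1) * (4 * i + 1))) (N + 1),
          Finset.sum_range_succ (fun i => q ^ ((4 * i + 1) * (4 * i + 5) + 4)) N]
        ring
    rw [h2, h1]
    ring
  have hk' := hμ k
  rw [hθ, Fintype.sum_pow, trace_pow_eq_sum_prod_finRotate _ hk,
    trace_pow_eq_sum_prod_finRotate _ hk] at hk'
  simp only [cyclicMatrix, cyclicMatrixThree, Matrix.of_apply, Finset.prod_pow_eq_pow_sum] at hk'
  rw [hk', eq_sub_iff_add_eq]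
  congr 2
  refine Finset.sum_congr rfl fun x _ => ?_
  congr 1
  -- the two exponents differ by the telescoping sum of the `8 (x i - x (i + 1))`
  have hrot : ∑ i, (x (finRotate k i) : ℕ) = ∑ i, (x i : ℕ) :=
    Equiv.sum_comp (finRotate k) fun i => (x i : ℕ)
  have h1 : ∀ i, (4 * (x i : ℕ) + 3) * (4 * (x (finRotate k i) : ℕ) + 3) + 8 * (x i : ℕ) =
      ((4 * (x i : ℕ) + 1) * (4 * (x (finRotate k i) : ℕ) + 5) + 4) +
        8 * (x (finRotate k i) : ℕ) := fun i => by ring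
  have h2 := Finset.sum_congr (rfl : (Finset.univ : Finset (Fin k)) = _) fun i _ => h1 i
  rw [Finset.sum_add_distrib, Finset.sum_add_distrib, ← Finset.mul_sum, ← Finset.mul_sum,
    hrot] at h2
  exact Nat.add_right_cancel h2

end Intertwiner

/-! ### Counting -/

/-- If `Q` dominates all coordinates, the solutions of `Q x = n` in residue class `a` modulo `b`
can be counted among the `x = b y + a` with `y` bounded. -/
theorem ncard_residue_class_eq_card {a b k n N : ℕ} (ha : 0 < a) (hab : a < b) (hN : n ≤ N)
    (Q : (Fin k → ℕ) → ℕ) (hQ : ∀ x, (∀ i, 0 < x i) → ∀ i, x i ≤ Q x) :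
    {x : Fin k → ℕ | (∀ i, 0 < x i ∧ x i ≡ a [MOD b]) ∧ n = Q x}.ncard =
      (Finset.univ.filter fun y : Fin k → Fin N => Q (fun i => b * (y i : ℕ) + a) = n).card := by
  have hinj : Function.Injective fun (y : Fin k → Fin N) (i : Fin k) => b * (y i : ℕ) + a := by
    intro y z hyz
    ext i
    have := congrFun hyz i
    simp only [Nat.add_right_cancel_iff] at this
    exact Nat.eq_of_mul_eq_mul_left (by omega) this
  rw [← Set.ncard_coe_finset, ← Set.ncard_image_of_injective _ hinj]
  congr 1
  ext x
  simp only [Set.mem_ofPred_eq, Set.mem_image, Finset.coe_filter, Finset.mem_univ, true_and]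
  constructor
  · rintro ⟨hx, hn⟩
    have hdiv : ∀ i, b * (x i / b) + a = x i := fun i => by
      have h := (hx i).2
      rw [Nat.ModEq, Nat.mod_eq_of_lt hab] at h
      rw [← h, Nat.div_add_mod]
    have hlt : ∀ i, x i / b < N := fun i => by
      have h1 := hQ x (fun i => (hx i).1) i
      have h2 : x i / b ≤ b * (x i / b) := Nat.le_mul_of_pos_left _ (by omega)
      have h3 := hdiv i
      omega
    refine ⟨fun i => ⟨x i / b, hlt i⟩, ?_, ?_⟩
    · simp only [hdiv]
      exact hn.symm
    · funext i
      exact hdiv i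
  · rintro ⟨y, hy, rfl⟩
    exact ⟨fun i => ⟨Nat.add_pos_right _ ha, by simp [Nat.ModEq]⟩, hy.symm⟩

theorem rCount_eq_card {a b n N : ℕ} (k : ℕ) (ha : 0 < a) (hab : a < b) (hN : n ≤ N) :
    rCount a b k n = (Finset.univ.filter fun y : Fin k → Fin N =>
      ∑ i, (b * (y i : ℕ) + a) ^ 2 = n).card :=
  ncard_residue_class_eq_card ha hab hN (fun x => ∑ i, x i ^ 2) fun x _ i =>
    (Nat.le_self_pow two_ne_zero _).trans
      (Finset.single_le_sum (f := fun j => x j ^ 2) (fun _ _ => Nat.zero_le _) (Finset.mem_univ i))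

theorem cCount_eq_card {a b n N : ℕ} (k : ℕ) (ha : 0 < a) (hab : a < b) (hN : n ≤ N) :
    cCount a b k n = (Finset.univ.filter fun y : Fin k → Fin N =>
      ∑ i, (b * (y i : ℕ) + a) * (b * (y (finRotate k i) : ℕ) + a) = n).card :=
  ncard_residue_class_eq_card ha hab hN (fun x => ∑ i, x i * x (finRotate k i)) fun x hx i =>
    (Nat.le_mul_of_pos_right _ (hx _)).trans
      (Finset.single_le_sum (f := fun j => x j * x (finRotate k j))
        (fun _ _ => Nat.zero_le _) (Finset.mem_univ i))

theorem coeff_sum_X_pow {T : Type*} [Fintype T] (e : T → ℕ) (n : ℕ) :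
    (∑ t, (Polynomial.X : Polynomial ℤ) ^ e t).coeff n =
      (Finset.univ.filter fun t => e t = n).card := by
  simp [Polynomial.finsetSum_coeff, Polynomial.coeff_X_pow, eq_comm]

theorem mainTheorem2 (k n : ℕ) (hk : 0 < k) (hn : 0 < n) :
    (rCount 1 2 k n : ℤ) = (cCount 1 4 k n : ℤ) - (-1) ^ k * (cCount 3 4 k n : ℤ) := by
  rw [rCount_eq_card (N := 2 * n + 1) k one_pos one_lt_two (by omega),
    cCount_eq_card (N := n + 1) k one_pos (by norm_num) (by omega),
    cCount_eq_card (N := n) k three_pos (by norm_num) le_rfl]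
  -- working modulo `X ^ (n + 1)` keeps the coefficient of `X ^ n`
  let π := Ideal.Quotient.mk (Ideal.span {(Polynomial.X : Polynomial ℤ) ^ (n + 1)})
  have hq : π Polynomial.X ^ (n + 1) = 0 := by
    rw [← map_pow]
    exact Ideal.Quotient.eq_zero_iff_mem.2 (Ideal.mem_span_singleton_self _)
  have key := sum_pow_sq_pow_eq hq hk
  have hneg : (-1) ^ k = π (Polynomial.C ((-1) ^ k)) := by simp
  simp only [hneg, ← map_pow π, ← map_sum π, ← map_mul π, ← map_sub π] at key
  have hdvd := Ideal.mem_span_singleton.1 (Ideal.Quotient.eq.1 key)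
  have hcoeff := Polynomial.X_pow_dvd_iff.1 hdvd n n.lt_succ_self
  rw [Polynomial.coeff_sub, Polynomial.coeff_sub, Polynomial.coeff_C_mul, coeff_sum_X_pow,
    coeff_sum_X_pow, coeff_sum_X_pow] at hcoeff
  exact sub_eq_zero.1 hcoeff
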